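/- Let $\mathbb K\in\{\mathbb R,\mathbb C\}$, let $\mathbb M_{M,N}$ be the space of $M\times N$ matrices over $\mathbb K$ with the Frobenius norm $\|\cdot\|$ and inner product $\langle A,B\rangle=\operatorname{tr}(A^*B)$, and let $\sigma_1(A)\ge\dots\ge\sigma_{\min(M,N)}(A)\ge 0$ denote the singular values of $A$, counted with multiplicity. Let $\mathcal H\subset\mathbb M_{M,N}$ be a linear subspace, $F\in\mathcal H$, $\tau>0$, $1<q<\infty$, and let $\mathcal P_{\mathcal H}$, $\mathcal P_{\mathcal H^\perp}$ be the orthogonal projections onto $\mathcal H$ and $\mathcal H^\perp$. Put $$\mathcal R_\tau(A)=\sum_j\Big(\tau^2-\big(\max(\tau-\sigma_j(A),0)\big)^2\Big),\qquad s_{\tau,q}(\sigma)=\max\big(\min(\sigma,\tau),\sigma/q\big).$$ For $f$ with $f(0)=0$ let $\mathfrak S_f(A)=U\operatorname{diag}(f(\sigma_j(A)))V^*$, where $A=U\operatorname{diag}(\sigma_j(A))V^*$ is a singular value decomposition, with $U$ and $V$ unitary and the singular values in non-increasing order. Let $\mathfrak B(W)=\mathfrak S_{s_{\tau,q}}\big(qF+\mathcal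 P_{\mathcal H^\perp}(W)\big)$. Let $W^\circ$ be any fixed point of $\mathfrak B$ (for instance a limit of the iteration $W^{n+1}=\mathfrak B(W^n)$), and let $A^\circ=\frac1{q-1}\big(qF-\mathcal P_{\mathcal H}(W^\circ)\big)$. Then: 1. $A^\circ\in\mathcal H$, and $A^\circ$ is the unique minimizer of $\mathcal R_\tau(A)+q\|A-F\|^2$ over $A\in\mathcal H$. Moreover $A^\circ$ minimizes $\mathcal R_\tau(A)+\|A-W^\circ\|^2$ over all $A\in\mathbb M_{M,N}$. 2. There are unitary $U,V$ with $W^\circ=U\operatorname{diag}(\sigma_j(W^\circ))V^*$ and $A^\circ=U\operatorname{diag}(\sigma_j(A^\circ))V^*$. If at most one index $j$ satisfies $\sigma_j(W^\circ)=\tau$, then every singular value decomposition $W^\circ=U\operatorname{diag}(\sigma_j(W^\circ))V^*$ yields $A^\circ=U\operatorname{diag}(\sigma_j(A^\circ))V^*$. 3. For every $j$: $\sigma_j(A^\circ)=\sigma_j(W^\circ)$ if $\sigma_j(W^\circ)>\tau$; $0\le\sigma_j(A^\circ)\le\sigma_j(W^\circ)$ if $\sigma_j(W^\circ)=\tau$;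 and $\sigma_j(A^\circ)=0$ if $\sigma_j(W^\circ)<\tau$. 4. If no singular value of $W^\circ$ equals $\tau$, then $A^\circ$ is the unique minimizer of $\tau^2\operatorname{rank}(A)+q\|A-F\|^2$ over $A\in\mathcal H$. -/

import Mathlib

open scoped Matrix

attribute [local instance] Matrix.frobeniusNormedAddCommGroup Matrix.frobeniusNormedSpace

/-- The Euclidean structure on `M × N` matrices: the inner product `⟪A, B⟫ = tr (Aᴴ B)`,
whose norm is the Frobenius norm. -/
noncomputable abbrev frobeniusInnerProductSpace {𝕜 : Type*} [RCLike 𝕜] (M N : ℕ) :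
    InnerProductSpace 𝕜 (Matrix (Fin M) (Fin N) 𝕜) where
  inner A B := (Aᴴ * B).trace
  norm_sq_eq_re_inner A := by
    rw [Matrix.frobenius_norm_def, ← Real.sqrt_eq_rpow, Real.sq_sqrt (by positivity)]
    simp only [Matrix.trace, Matrix.diag_apply, Matrix.mul_apply, Matrix.conjTranspose_apply,
      map_sum]
    rw [Finset.sum_comm]
    refine Finset.sum_congr rfl fun i _ => Finset.sum_congr rfl fun j _ => ?_
    rw [RCLike.star_def, RCLike.conj_mul]
    norm_cast
  conj_inner_symm A B := by
    rw [← RCLike.star_def, ← Matrix.trace_conjTranspose, Matrix.conjTranspose_mul,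
      Matrix.conjTranspose_conjTranspose]
  add_left A B C := by
    rw [Matrix.conjTranspose_add, Matrix.add_mul, Matrix.trace_add]
  smul_left A B r := by
    rw [Matrix.conjTranspose_smul, Matrix.smul_mul, Matrix.trace_smul, smul_eq_mul,
      RCLike.star_def]

attribute [local instance] frobeniusInnerProductSpace

/-- `σ_j(A)`: the singular values of `A` in non-increasing order, counted with multiplicity and
indexed from `0`. The `min M N` singular values of an `M × N` matrix are those with
`j < min M N`; the remaining terms of the sequence are `0`. -/
noncomputable def singVal {𝕜 : Type*} [RCLike 𝕜] {M N : ℕ}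
    (A : Matrix (Fin M) (Fin N) 𝕜) (j : ℕ) : ℝ :=
  (Matrix.toEuclideanLin A).singularValues j

/-- The rectangular `M × N` diagonal matrix with diagonal entries `d 0, d 1, …`. -/
def rectDiag (𝕜 : Type*) [RCLike 𝕜] (M N : ℕ) (d : ℕ → ℝ) : Matrix (Fin M) (Fin N) 𝕜 :=
  Matrix.of fun i j => if (i : ℕ) = (j : ℕ) then ((d j : ℝ) : 𝕜) else 0

/-- `A = U diag(σ_j(A)) Vᴴ` with `U` and `V` unitary. -/
def IsSVD {𝕜 : Type*} [RCLike 𝕜] {M N : ℕ} (A : Matrix (Fin M) (Fin N) 𝕜)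
    (U : Matrix (Fin M) (Fin M) 𝕜) (V : Matrix (Fin N) (Fin N) 𝕜) : Prop :=
  U ∈ Matrix.unitaryGroup (Fin M) 𝕜 ∧ V ∈ Matrix.unitaryGroup (Fin N) 𝕜 ∧
    A = U * rectDiag 𝕜 M N (singVal A) * Vᴴ

theorem mem_unitaryGroup_of_orthonormalBasis {𝕜 : Type*} [RCLike 𝕜] {n : ℕ}
    (b : OrthonormalBasis (Fin n) 𝕜 (EuclideanSpace 𝕜 (Fin n))) :
    (Matrix.of fun i j => b j i) ∈ Matrix.unitaryGroup (Fin n) 𝕜 := by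
  rw [Matrix.mem_unitaryGroup_iff']
  ext i j
  have h := orthonormal_iff_ite.1 b.orthonormal i j
  rw [EuclideanSpace.inner_eq_star_dotProduct] at h
  rw [Matrix.mul_apply, Matrix.one_apply, ← h]
  simp only [Matrix.star_apply, Matrix.of_apply, dotProduct, Pi.star_apply]
  exact Finset.sum_congr rfl fun k _ => mul_comm _ _

/-- Every matrix has a singular value decomposition. -/
theorem exists_isSVD {𝕜 : Type*} [RCLike 𝕜] {M N : ℕ} (A : Matrix (Fin M) (Fin N) 𝕜) :
    ∃ U V, IsSVD A U V := by
  classical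
  set T := Matrix.toEuclideanLin A with hT
  have hn : Module.finrank 𝕜 (EuclideanSpace 𝕜 (Fin N)) = N := by simp
  let v := T.isSymmetric_adjoint_comp_self.eigenvectorBasis hn
  have hTT : ∀ i j, inner 𝕜 (T (v i)) (T (v j))
      = if i = j then (((singVal A i) ^ 2 : ℝ) : 𝕜) else 0 := by
    intro i j
    have h1 := T.isSymmetric_adjoint_comp_self.apply_eigenvectorBasis hn j
    rw [← LinearMap.adjoint_inner_right]
    change inner 𝕜 (v i) ((LinearMap.adjoint T ∘ₗ T) (v j)) = _
    rw [h1, inner_smul_right, orthonormal_iff_ite.1 v.orthonormal i j,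
      ← T.sq_singularValues_fin hn j]
    split_ifs with h
    · subst h; simp [singVal, hT]
    · simp
  have hzero : ∀ j : Fin N, singVal A j = 0 → T (v j) = 0 := by
    intro j hj
    have := hTT j j
    simpa [hj] using this
  have hlt : ∀ j : ℕ, singVal A j ≠ 0 → j < M := by
    intro j hj
    have h1 := (T.singularValues_pos_iff_lt_finrank_range (n := j)).1
      ((T.singularValues_pos_iff_ne_zero j).2 hj)
    have h2 : Module.finrank 𝕜 T.range ≤ Module.finrank 𝕜 (EuclideanSpace 𝕜 (Fin M)) :=
      Submodule.finrank_le _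
    simp only [finrank_euclideanSpace, Fintype.card_fin] at h2
    omega
  have hltN : ∀ j : ℕ, singVal A j ≠ 0 → j < N := by
    intro j hj
    by_contra h
    exact hj (T.singularValues_of_finrank_le (by simpa using h))
  let u : Fin M → EuclideanSpace 𝕜 (Fin M) := fun i =>
    if h : (i : ℕ) < N then (((singVal A i)⁻¹ : ℝ) : 𝕜) • T (v ⟨i, h⟩) else 0
  let s : Set (Fin M) := {i | singVal A i ≠ 0}
  have hu : Orthonormal 𝕜 (s.domRestrict u) := by
    rw [orthonormal_iff_ite]
    rintro ⟨i, hi⟩ ⟨j, hj⟩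
    have hi' := hltN _ hi
    have hj' := hltN _ hj
    simp only [Set.domRestrict_apply, u, hi', hj', dif_pos, inner_smul_left, inner_smul_right,
      hTT, RCLike.conj_ofReal, Subtype.mk.injEq, Fin.mk.injEq, Fin.val_inj]
    split_ifs with h
    · subst h
      have : singVal A i ≠ 0 := hi
      norm_cast
      field_simp
    · simp
  obtain ⟨b, hb⟩ := hu.exists_orthonormalBasis_extension_of_card_eq (by simp)
  refine ⟨Matrix.of fun i j => b j i, Matrix.of fun i j => v j i,
    mem_unitaryGroup_of_orthonormalBasis b, mem_unitaryGroup_of_orthonormalBasis v, ?_⟩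
  have hV := mem_unitaryGroup_of_orthonormalBasis v
  have key : A * (Matrix.of fun i j => v j i)
      = (Matrix.of fun i j => b j i) * rectDiag 𝕜 M N (singVal A) := by
    ext i j
    have e1 : (A * (Matrix.of fun i j => v j i)) i j = T (v j) i := by
      simp [hT, Matrix.mul_apply, Matrix.toLpLin_apply, Matrix.mulVec, dotProduct]
    rw [e1, Matrix.mul_apply]
    by_cases h : singVal A j = 0
    · rw [hzero j h]
      symm
      simp only [PiLp.zero_apply]
      refine Finset.sum_eq_zero fun k _ => ?_
      simp [rectDiag, h]
    · have hjM := hlt _ h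
      rw [Finset.sum_eq_single ⟨j, hjM⟩]
      · have hbj := hb ⟨j, hjM⟩ h
        simp only [Matrix.of_apply, hbj, u, rectDiag, j.2, dif_pos, if_true, Fin.eta,
          PiLp.smul_apply, smul_eq_mul]
        have h' : ((singVal A j : ℝ) : 𝕜) ≠ 0 := by exact_mod_cast h
        push_cast
        field_simp
      · intro k _ hk
        have : (k : ℕ) ≠ j := fun e => hk (Fin.ext e)
        simp [rectDiag, this]
      · simp
  rw [← key, Matrix.mul_assoc, ← Matrix.star_eq_conjTranspose, Matrix.mem_unitaryGroup_iff.1 hV,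
    Matrix.mul_one]

/-- The singular value functional calculus `𝔖_f(A) = U diag(f(σ_j(A))) Vᴴ`, where
`A = U diag(σ_j(A)) Vᴴ` is a singular value decomposition (for `f 0 = 0` the result does not
depend on which one). -/
noncomputable def svCalculus {𝕜 : Type*} [RCLike 𝕜] {M N : ℕ} (f : ℝ → ℝ)
    (A : Matrix (Fin M) (Fin N) 𝕜) : Matrix (Fin M) (Fin N) 𝕜 :=
  (exists_isSVD A).choose * rectDiag 𝕜 M N (fun j => f (singVal A j)) *
    ((exists_isSVD A).choose_spec.choose)ᴴ

/-- `s_{τ,q}(σ) = max (min σ τ) (σ / q)`. -/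
noncomputable def sFun (τ q σ : ℝ) : ℝ := max (min σ τ) (σ / q)

/-- `R_τ(A) = ∑_j (τ² - max(τ - σ_j(A), 0)²)`, the sum being over the `min M N` singular values. -/
noncomputable def rankReg {𝕜 : Type*} [RCLike 𝕜] {M N : ℕ} (τ : ℝ)
    (A : Matrix (Fin M) (Fin N) 𝕜) : ℝ :=
  ∑ j ∈ Finset.range (min M N), (τ ^ 2 - (max (τ - singVal A j) 0) ^ 2)

theorem hasOrthogonalProjection_of_finiteDimensional {𝕜 E : Type*} [RCLike 𝕜]
    [NormedAddCommGroup E] [InnerProductSpace 𝕜 E] [FiniteDimensional 𝕜 E]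
    (H : Submodule 𝕜 E) : H.HasOrthogonalProjection :=
  inferInstance

/-- Subspaces of the finite-dimensional space of matrices have orthogonal projections. -/
instance hasOrthogonalProjection_matrix {𝕜 : Type*} [RCLike 𝕜] {M N : ℕ}
    (H : Submodule 𝕜 (Matrix (Fin M) (Fin N) 𝕜)) : H.HasOrthogonalProjection :=
  hasOrthogonalProjection_of_finiteDimensional H

/-- The orthogonal projection `P_H` of matrices onto `H` in the Frobenius inner product. -/
noncomputable def orthProj {𝕜 : Type*} [RCLike 𝕜] {M N : ℕ}
    (H : Submodule 𝕜 (Matrix (Fin M) (Fin N) 𝕜)) (W : Matrix (Fin M) (Fin N) 𝕜) :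
    Matrix (Fin M) (Fin N) 𝕜 :=
  H.starProjection W

/-- The operator `𝔅_{F,τ,q}(W) = 𝔖_{s_{τ,q}}(q F + P_{H^⊥}(W))`. -/
noncomputable def fixedPointMap {𝕜 : Type*} [RCLike 𝕜] {M N : ℕ}
    (H : Submodule 𝕜 (Matrix (Fin M) (Fin N) 𝕜)) (F : Matrix (Fin M) (Fin N) 𝕜) (τ q : ℝ)
    (W : Matrix (Fin M) (Fin N) 𝕜) : Matrix (Fin M) (Fin N) 𝕜 :=
  svCalculus (sFun τ q) ((q : 𝕜) • F + orthProj H.orthogonal W)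

/-! ### Singular values -/

section SingularValues

variable {𝕜 : Type*} [RCLike 𝕜] {M N : ℕ}

/-! Put `Z = qF + P_{H^⊥}(W₀)`. The definition of `A₀` says exactly that `W₀ + (q - 1) A₀ = Z`, and
the fixed point equation says that `W₀` is `Z` with each singular value `z` replaced by `s(z) = sFun
τ q z`. Hence `A₀` is `Z` with `z` replaced by `t(z) = (z - s(z)) / (q - 1)`. On `[0, ∞)` both `s`
and `t` are nonnegative and nondecreasing, so `W₀` and `A₀` have a common singular value
decomposition and their ordered singular values are `s(σ_j(Z))` and `t(σ_j(Z))`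
(`singVal_eq_of_eq_mul_rectDiag_mul`).

The three regimes of `(s, t)` in `sFun_tFun_cases` are such that `a = t` minimizes `τ² - max(τ - a,
0)² + (a - s)²` over `a ≥ 0` (`scalar_objective_le`). Von Neumann's trace inequality, an equality
for common singular vectors, lifts this to matrices: `A₀` minimizes `R_τ(A) + ‖A - W₀‖²` over all
`A`.

Since `W₀ + (q - 1) A₀ - qF = P_{H^⊥}(W₀)` is orthogonal to `H`, on `H` the term `q ‖A - F‖²` equals
`‖A - W₀‖² + (q - 1) ‖A - A₀‖²` up to a constant. The first summand is handled by the global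
minimality, and the second gives strict uniqueness because `q > 1`. Finally `R_τ ≤ τ² rank`, with
equality when no singular value lies in `(0, τ)`; this transfers the result to the rank penalty. -/

theorem singVal_nonneg (A : Matrix (Fin M) (Fin N) 𝕜) (j : ℕ) : 0 ≤ singVal A j :=
  LinearMap.singularValues_nonneg _ j

theorem singVal_antitone (A : Matrix (Fin M) (Fin N) 𝕜) : Antitone (singVal A) :=
  LinearMap.singularValues_antitone _

theorem rank_eq_finrank_range_toEuclideanLin (A : Matrix (Fin M) (Fin N) 𝕜) :
    A.rank = Module.finrank 𝕜 (Matrix.toEuclideanLin A).range := by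
  rw [Matrix.toEuclideanLin_eq_toLin_orthonormal]
  exact Matrix.rank_eq_finrank_range_toLin A _ _

theorem singVal_eq_zero_iff_rank_le (A : Matrix (Fin M) (Fin N) 𝕜) (j : ℕ) :
    singVal A j = 0 ↔ A.rank ≤ j := by
  rw [rank_eq_finrank_range_toEuclideanLin]
  exact LinearMap.singularValues_eq_zero_iff_le_finrank_range _

theorem rank_le_min (A : Matrix (Fin M) (Fin N) 𝕜) : A.rank ≤ min M N :=
  le_min (by simpa using A.rank_le_card_height) (by simpa using A.rank_le_card_width)

theorem singVal_eq_zero_of_min_le (A : Matrix (Fin M) (Fin N) 𝕜) {j : ℕ} (hj : min M N ≤ j) :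
    singVal A j = 0 :=
  (singVal_eq_zero_iff_rank_le A j).2 ((rank_le_min A).trans hj)

/-- For `N > M` the columns with index at least `M` have no diagonal slot, so `d` must vanish there
for the product to be diagonal with all entries `d j * e j`. -/
theorem rectDiag_conjTranspose_mul_rectDiag {d e : ℕ → ℝ} (hd : ∀ j, M ≤ j → d j = 0) :
    (rectDiag 𝕜 M N d)ᴴ * rectDiag 𝕜 M N e =
      Matrix.diagonal fun j : Fin N => ((d j * e j : ℝ) : 𝕜) := by
  ext i j
  rw [Matrix.mul_apply, Matrix.diagonal_apply]
  simp only [rectDiag, Matrix.conjTranspose_apply, Matrix.of_apply]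
  by_cases hi : (i : ℕ) < M
  · rw [Finset.sum_eq_single (⟨i, hi⟩ : Fin M)]
    · by_cases hij : i = j
      · subst hij; simp
      · have : (i : ℕ) ≠ j := fun h => hij (Fin.ext h)
        simp [hij, this]
    · intro k _ hk
      have : (k : ℕ) ≠ i := fun h => hk (Fin.ext h)
      simp [this]
    · simp
  · rw [Finset.sum_eq_zero]
    · simp [hd i (not_lt.1 hi)]
    · intro k _
      have : (k : ℕ) ≠ i := by have := k.2; omega
      simp [this]

theorem conjTranspose_mul_of_common_svd {U : Matrix (Fin M) (Fin M) 𝕜}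
    {V : Matrix (Fin N) (Fin N) 𝕜} (hU : U ∈ Matrix.unitaryGroup (Fin M) 𝕜)
    {d e : ℕ → ℝ} (hd : ∀ j, M ≤ j → d j = 0) :
    (U * rectDiag 𝕜 M N d * Vᴴ)ᴴ * (U * rectDiag 𝕜 M N e * Vᴴ) =
      V * (Matrix.diagonal fun j : Fin N => ((d j * e j : ℝ) : 𝕜)) * Vᴴ := by
  have hU' : Uᴴ * U = 1 := Matrix.mem_unitaryGroup_iff'.1 hU
  rw [← rectDiag_conjTranspose_mul_rectDiag hd]
  simp only [Matrix.conjTranspose_mul, Matrix.conjTranspose_conjTranspose, Matrix.mul_assoc]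
  rw [← Matrix.mul_assoc Uᴴ U, hU', Matrix.one_mul]

/-- The singular values of `U diag(d) Vᴴ` are the non-increasing nonnegative numbers `d`. -/
theorem singVal_eq_of_eq_mul_rectDiag_mul {B : Matrix (Fin M) (Fin N) 𝕜}
    {U : Matrix (Fin M) (Fin M) 𝕜} {V : Matrix (Fin N) (Fin N) 𝕜}
    (hU : U ∈ Matrix.unitaryGroup (Fin M) 𝕜) (hV : V ∈ Matrix.unitaryGroup (Fin N) 𝕜)
    {d : ℕ → ℝ} (hd : Antitone d) (hd0 : ∀ j, 0 ≤ d j) (hdm : ∀ j, min M N ≤ j → d j = 0)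
    (hB : B = U * rectDiag 𝕜 M N d * Vᴴ) : singVal B = d := by
  classical
  have hn : Module.finrank 𝕜 (EuclideanSpace 𝕜 (Fin N)) = N := by simp
  set T := Matrix.toEuclideanLin B with hT
  have hTT : LinearMap.adjoint T ∘ₗ T = Matrix.toEuclideanLin (Bᴴ * B) := by
    rw [hT, ← Matrix.toEuclideanLin_conjTranspose_eq_adjoint]
    exact (Matrix.toLpLin_mul_same _ _ _).symm
  -- `BᴴB = V diag(d²) Vᴴ`, so the eigenvalues of the Gram operator can be read off its
  -- characteristic polynomial. As `d` is already ordered, sorting the roots changes nothing, and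
  -- square roots recover `d`.
  have hchar : (LinearMap.adjoint T ∘ₗ T).charpoly =
      ∏ j : Fin N, (Polynomial.X - Polynomial.C (((d j) ^ 2 : ℝ) : 𝕜)) := by
    rw [hTT, Matrix.toEuclideanLin_eq_toLin_orthonormal, Matrix.charpoly_toLin, hB,
      conjTranspose_mul_of_common_svd hU (fun j hj => hdm j ((min_le_left _ _).trans hj)),
      Matrix.charpoly_mul_comm, ← Matrix.mul_assoc,
      show Vᴴ * V = 1 from Matrix.mem_unitaryGroup_iff'.1 hV, Matrix.one_mul,
      Matrix.charpoly_diagonal]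
    simp [sq]
  have hroots : ((LinearMap.adjoint T ∘ₗ T).charpoly.roots.map RCLike.re).sort (· ≥ ·) =
      List.ofFn fun j : Fin N => (d j) ^ 2 := by
    rw [hchar, Polynomial.roots_prod _ _
      (Finset.prod_ne_zero_iff.2 fun _ _ => Polynomial.X_sub_C_ne_zero _)]
    simp only [Polynomial.roots_X_sub_C, Multiset.bind_singleton, Multiset.map_map]
    simp only [Fin.univ_val_map, Function.comp_def, RCLike.ofReal_re, Multiset.coe_sort]
    refine List.mergeSort_of_pairwise ?_
    simp_rw [decide_eq_true_eq, ← List.sortedGE_iff_pairwise]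
    refine Antitone.sortedGE_ofFn fun i j hij => ?_
    exact pow_le_pow_left₀ (hd0 _) (hd hij) 2
  rw [T.isSymmetric_adjoint_comp_self.sort_roots_charpoly_eq_eigenvalues hn,
    List.ofFn_inj] at hroots
  funext j
  by_cases hj : j < N
  · have h := congrFun hroots ⟨j, hj⟩
    change T.singularValues j = d j
    rw [T.singularValues_of_lt hn hj, h, Real.sqrt_sq (hd0 j)]
  · have hj' : min M N ≤ j := (min_le_right _ _).trans (not_lt.1 hj)
    rw [singVal_eq_zero_of_min_le B hj', hdm j hj']

theorem isSVD_of_eq_mul_rectDiag_mul {B : Matrix (Fin M) (Fin N) 𝕜}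
    {U : Matrix (Fin M) (Fin M) 𝕜} {V : Matrix (Fin N) (Fin N) 𝕜}
    (hU : U ∈ Matrix.unitaryGroup (Fin M) 𝕜) (hV : V ∈ Matrix.unitaryGroup (Fin N) 𝕜)
    {d : ℕ → ℝ} (hd : Antitone d) (hd0 : ∀ j, 0 ≤ d j) (hdm : ∀ j, min M N ≤ j → d j = 0)
    (hB : B = U * rectDiag 𝕜 M N d * Vᴴ) : IsSVD B U V :=
  ⟨hU, hV, by rw [singVal_eq_of_eq_mul_rectDiag_mul hU hV hd hd0 hdm hB]; exact hB⟩

/-- The singular value functional calculus does not depend on the decomposition: if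
`f` vanishes wherever `d` does and respects coincidences of `d`, then `U diag(f) Vᴴ` is determined
by `U diag(d) Vᴴ`. -/
theorem mul_rectDiag_mul_eq_of_eq {U U' : Matrix (Fin M) (Fin M) 𝕜}
    {V V' : Matrix (Fin N) (Fin N) 𝕜}
    (hU : U ∈ Matrix.unitaryGroup (Fin M) 𝕜) (hV : V ∈ Matrix.unitaryGroup (Fin N) 𝕜)
    (hU' : U' ∈ Matrix.unitaryGroup (Fin M) 𝕜) (hV' : V' ∈ Matrix.unitaryGroup (Fin N) 𝕜)
    {d f : ℕ → ℝ} (hd0 : ∀ j, 0 ≤ d j) (hdm : ∀ j, min M N ≤ j → d j = 0)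
    (hf0 : ∀ j, d j = 0 → f j = 0) (hf : ∀ i j, d i = d j → f i = f j)
    (h : U * rectDiag 𝕜 M N d * Vᴴ = U' * rectDiag 𝕜 M N d * V'ᴴ) :
    U * rectDiag 𝕜 M N f * Vᴴ = U' * rectDiag 𝕜 M N f * V'ᴴ := by
  have hU1 : Uᴴ * U = 1 := Matrix.mem_unitaryGroup_iff'.1 hU
  have hV1 : Vᴴ * V = 1 := Matrix.mem_unitaryGroup_iff'.1 hV
  have hU1' : U'ᴴ * U' = 1 := Matrix.mem_unitaryGroup_iff'.1 hU'
  have hV1' : V'ᴴ * V' = 1 := Matrix.mem_unitaryGroup_iff'.1 hV'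
  have hU2' : U' * U'ᴴ = 1 := Matrix.mem_unitaryGroup_iff.1 hU'
  have hV2 : V * Vᴴ = 1 := Matrix.mem_unitaryGroup_iff.1 hV
  -- With `P = U'ᴴU`, `Q = V'ᴴV` and `D = diag(d)`, the hypothesis becomes `PD = DQ` and `QDᴴ =
  -- DᴴP`. The goal is the same intertwining `PD_f = D_f Q` for `D_f = diag(f)`.
  have e1 : U'ᴴ * U * rectDiag 𝕜 M N d = rectDiag 𝕜 M N d * (V'ᴴ * V) := by
    have := congrArg (fun X => U'ᴴ * X * V) h
    simp only [Matrix.mul_assoc, hV1, Matrix.mul_one] at this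
    rw [← Matrix.mul_assoc U'ᴴ U', hU1', Matrix.one_mul] at this
    simpa [Matrix.mul_assoc] using this
  have e2 : (V'ᴴ * V) * (rectDiag 𝕜 M N d)ᴴ = (rectDiag 𝕜 M N d)ᴴ * (U'ᴴ * U) := by
    have := congrArg (fun X => V'ᴴ * Xᴴ * U) h
    simp only [Matrix.conjTranspose_mul, Matrix.conjTranspose_conjTranspose, Matrix.mul_assoc,
      hU1, Matrix.mul_one] at this
    rw [← Matrix.mul_assoc V'ᴴ V', hV1', Matrix.one_mul] at this
    simpa [Matrix.mul_assoc] using this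
  generalize hP : U'ᴴ * U = P at e1 e2
  generalize hQ : V'ᴴ * V = Q at e1 e2
  have hdM : ∀ j, M ≤ j → d j = 0 := fun j hj => hdm j ((min_le_left _ _).trans hj)
  have hdN : ∀ j, N ≤ j → d j = 0 := fun j hj => hdm j ((min_le_right _ _).trans hj)
  have key : P * rectDiag 𝕜 M N f = rectDiag 𝕜 M N f * Q := by
    have right : ∀ (g : ℕ → ℝ), (∀ j, d j = 0 → g j = 0) → ∀ (i : Fin M) (j : Fin N),
        (P * rectDiag 𝕜 M N g) i j = if hj : (j : ℕ) < M then P i ⟨j, hj⟩ * (g j : 𝕜) else 0 := by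
      intro g hg i j
      rw [Matrix.mul_apply]
      split_ifs with hj
      · rw [Finset.sum_eq_single (⟨j, hj⟩ : Fin M)]
        · simp [rectDiag]
        · intro k _ hk
          have : (k : ℕ) ≠ j := fun h => hk (Fin.ext h)
          simp [rectDiag, this]
        · simp
      · refine Finset.sum_eq_zero fun k _ => ?_
        simp [rectDiag, hg j (hdM j (not_lt.1 hj))]
    have left : ∀ (g : ℕ → ℝ), (∀ j, d j = 0 → g j = 0) → ∀ (i : Fin M) (j : Fin N),
        (rectDiag 𝕜 M N g * Q) i j = if hi : (i : ℕ) < N then (g i : 𝕜) * Q ⟨i, hi⟩ j else 0 := by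
      intro g hg i j
      rw [Matrix.mul_apply]
      split_ifs with hi
      · rw [Finset.sum_eq_single (⟨i, hi⟩ : Fin N)]
        · simp [rectDiag]
        · intro k _ hk
          have : (i : ℕ) ≠ k := fun h => hk (Fin.ext h.symm)
          simp [rectDiag, this]
        · simp
      · refine Finset.sum_eq_zero fun k _ => ?_
        have : (i : ℕ) ≠ k := by have := k.2; omega
        simp [rectDiag, this]
    ext i j
    rw [right f hf0, left f hf0]
    have h1 := congrFun (congrFun e1 i) j
    rw [right d (fun _ h => h), left d (fun _ h => h)] at h1
    by_cases hi : (i : ℕ) < N <;> by_cases hj : (j : ℕ) < M <;>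
      simp only [hi, hj, dif_pos, dif_neg, not_false_eq_true] at h1 ⊢
    · have h2 : Q ⟨i, hi⟩ j * (d j : 𝕜) = (d i : 𝕜) * P i ⟨j, hj⟩ := by
        have h2 := congrFun (congrFun e2 ⟨i, hi⟩) ⟨j, hj⟩
        rw [Matrix.mul_apply, Matrix.mul_apply, Finset.sum_eq_single j,
          Finset.sum_eq_single i] at h2
        · simpa [rectDiag] using h2
        · intro k _ hk
          have : (k : ℕ) ≠ i := fun h => hk (Fin.ext h)
          simp [rectDiag, this]
        · simp
        · intro k _ hk
          have : (j : ℕ) ≠ k := fun h => hk (Fin.ext h.symm)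
          simp [rectDiag, this]
        · simp
      by_cases hij : d i = d j
      · by_cases h0 : d j = 0
        · simp [hf0 _ h0, hf0 _ (hij.trans h0)]
        · have h0' : (d j : 𝕜) ≠ 0 := by exact_mod_cast h0
          rw [hij, mul_comm] at h1
          rw [mul_left_cancel₀ h0' h1, hf i j hij, mul_comm]
      -- The two relations combine to `(d_j² - d_i²) P_ij = 0`, and likewise for `Q`. So `P` and `Q`
      -- only mix indices with equal `d`, where `f` is constant.
      · have hsq : ((d j : 𝕜) ^ 2 - (d i : 𝕜) ^ 2) ≠ 0 := by
          have : (d j) ^ 2 - (d i) ^ 2 ≠ 0 := by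
            intro h
            exact hij ((sq_eq_sq₀ (hd0 i) (hd0 j)).1 (by linarith))
          exact_mod_cast this
        have hP0 : P i ⟨j, hj⟩ = 0 := by
          refine (mul_eq_zero.1 ?_).resolve_left hsq
          linear_combination (d j : 𝕜) * h1 + (d i : 𝕜) * h2
        have hQ0 : Q ⟨i, hi⟩ j = 0 := by
          refine (mul_eq_zero.1 ?_).resolve_left hsq
          linear_combination (d i : 𝕜) * h1 + (d j : 𝕜) * h2
        simp [hP0, hQ0]
    -- Outside the square block one side of the relation is absent, so the remaining product with
    -- `d` vanishes, and `f` vanishes wherever `d` does.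
    · rcases mul_eq_zero.1 h1.symm with h | h
      · simp [hf0 i (by exact_mod_cast h)]
      · simp [h]
    · rcases mul_eq_zero.1 h1 with h | h
      · simp [h]
      · simp [hf0 j (by exact_mod_cast h)]
  calc U * rectDiag 𝕜 M N f * Vᴴ = U' * U'ᴴ * U * rectDiag 𝕜 M N f * Vᴴ := by
        rw [hU2', Matrix.one_mul]
    _ = U' * (P * rectDiag 𝕜 M N f) * Vᴴ := by rw [← hP]; simp only [Matrix.mul_assoc]
    _ = U' * rectDiag 𝕜 M N f * V'ᴴ * (V * Vᴴ) := by
        rw [key, ← hQ]; simp only [Matrix.mul_assoc]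
    _ = U' * rectDiag 𝕜 M N f * V'ᴴ := by rw [hV2, Matrix.mul_one]

end SingularValues

/-! ### The von Neumann trace inequality -/

section TraceInequality

/-- By Birkhoff's theorem `S` is a convex combination of permutation matrices, and for each
permutation the bound is the rearrangement inequality. -/
theorem sum_mul_le_of_mem_doublyStochastic {n : Type*} [Fintype n] [DecidableEq n]
    {S : Matrix n n ℝ} (hS : S ∈ doublyStochastic ℝ n) {a b : n → ℝ} (hab : Monovary a b) :
    ∑ i, ∑ k, a i * b k * S i k ≤ ∑ i, a i * b i := by
  obtain ⟨w, hw0, hw1, rfl⟩ := exists_eq_sum_perm_of_mem_doublyStochastic hS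
  have e : ∀ i, ∑ k, a i * b k * (∑ σ, w σ • σ.permMatrix ℝ : Matrix n n ℝ) i k =
      ∑ σ, w σ * (a i * b (σ i)) := by
    intro i
    simp only [Matrix.sum_apply, Matrix.smul_apply, smul_eq_mul, Finset.mul_sum]
    rw [Finset.sum_comm]
    refine Finset.sum_congr rfl fun σ _ => ?_
    rw [Finset.sum_eq_single (σ i)]
    · simp [Equiv.Perm.permMatrix, PEquiv.toMatrix_apply]; ring
    · intro k _ hk
      simp [Equiv.Perm.permMatrix, PEquiv.toMatrix_apply, hk.symm]
    · simp
  simp only [e]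
  rw [Finset.sum_comm]
  calc ∑ σ, ∑ i, w σ * (a i * b (σ i)) ≤ ∑ σ, w σ * ∑ i, a i * b i := by
        refine Finset.sum_le_sum fun σ _ => ?_
        rw [← Finset.mul_sum]
        exact mul_le_mul_of_nonneg_left hab.sum_mul_comp_perm_le_sum_mul (hw0 σ)
    _ = ∑ i, a i * b i := by rw [← Finset.sum_mul, hw1, one_mul]

variable {𝕜 : Type*} [RCLike 𝕜] {M N : ℕ}

theorem norm_sq_mem_doublyStochastic {n : Type*} [Fintype n] [DecidableEq n]
    {P : Matrix n n 𝕜} (hP : P ∈ Matrix.unitaryGroup n 𝕜) :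
    (Matrix.of fun i k => ‖P i k‖ ^ 2) ∈ doublyStochastic ℝ n := by
  rw [mem_doublyStochastic_iff_sum]
  refine ⟨fun i j => by simp only [Matrix.of_apply]; positivity, fun i => ?_, fun j => ?_⟩
  · have h := congrFun (congrFun (Matrix.mem_unitaryGroup_iff.1 hP) i) i
    simp only [Matrix.mul_apply, Matrix.star_apply, RCLike.star_def, RCLike.mul_conj,
      Matrix.one_apply_eq] at h
    simp only [Matrix.of_apply]
    exact_mod_cast h
  · have h := congrFun (congrFun (Matrix.mem_unitaryGroup_iff'.1 hP) j) j
    simp only [Matrix.mul_apply, Matrix.star_apply, RCLike.star_def, RCLike.conj_mul,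
      Matrix.one_apply_eq] at h
    simp only [Matrix.of_apply]
    exact_mod_cast h

theorem sum_fin_eq_sum_range_min {n : ℕ} (hn : min M N ≤ n) {f : ℕ → ℝ}
    (hf : ∀ j, min M N ≤ j → f j = 0) :
    ∑ j : Fin n, f j = ∑ j ∈ Finset.range (min M N), f j := by
  rw [Fin.sum_univ_eq_sum_range f n]
  symm
  refine Finset.sum_subset (by simpa using hn) fun j _ hj => hf j ?_
  exact not_lt.1 fun h => hj (Finset.mem_range.2 h)

/-- The size `n` is left free so that the bound serves both the left factor (`n = M`) and the right
factor (`n = N`); singular values beyond `min M N` are zero padding. -/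
theorem sum_singVal_mul_le (A B : Matrix (Fin M) (Fin N) 𝕜) {n : ℕ} (hn : min M N ≤ n)
    {P : Matrix (Fin n) (Fin n) 𝕜} (hP : P ∈ Matrix.unitaryGroup (Fin n) 𝕜) :
    ∑ i : Fin n, ∑ k : Fin n, singVal A i * singVal B k * ‖P i k‖ ^ 2 ≤
      ∑ j ∈ Finset.range (min M N), singVal A j * singVal B j := by
  rw [← sum_fin_eq_sum_range_min hn (f := fun j => singVal A j * singVal B j)
    (fun j hj => by simp [singVal_eq_zero_of_min_le A hj])]
  refine sum_mul_le_of_mem_doublyStochastic (norm_sq_mem_doublyStochastic hP)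
    (a := fun i : Fin n => singVal A i) (b := fun i : Fin n => singVal B i) ?_
  refine Antitone.monovary ?_ ?_
  · exact fun i j hij => singVal_antitone A hij
  · exact fun i j hij => singVal_antitone B hij

/-- **Von Neumann's trace inequality.** -/
theorem re_trace_conjTranspose_mul_le (A B : Matrix (Fin M) (Fin N) 𝕜) :
    RCLike.re (Aᴴ * B).trace ≤
      ∑ j ∈ Finset.range (min M N), singVal A j * singVal B j := by
  obtain ⟨U, V, hU, hV, hA⟩ := exists_isSVD A
  obtain ⟨U', V', hU', hV', hB⟩ := exists_isSVD B
  set P := Uᴴ * U' with hP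
  set Q := Vᴴ * V' with hQ
  have hPu : P ∈ Matrix.unitaryGroup (Fin M) 𝕜 := mul_mem (Unitary.star_mem hU) hU'
  have hQu : Q ∈ Matrix.unitaryGroup (Fin N) 𝕜 := mul_mem (Unitary.star_mem hV) hV'
  -- The real entries of the rectangular diagonal matrix. Keeping them in a fourfold sum lets `P`
  -- and `Q`, of different sizes, be treated together; row and column sums of `r` later collapse the
  -- extra indices.
  let r : (ℕ → ℝ) → Fin M → Fin N → ℝ := fun d i j => if (i : ℕ) = j then d j else 0
  have hr : ∀ d i j, rectDiag 𝕜 M N d i j = (r d i j : 𝕜) := by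
    intro d i j
    simp only [rectDiag, Matrix.of_apply, r]
    split_ifs <;> simp
  have hr0 : ∀ (X : Matrix (Fin M) (Fin N) 𝕜) i j, 0 ≤ r (singVal X) i j := by
    intro X i j
    simp only [r]
    split_ifs
    exacts [singVal_nonneg X _, le_rfl]
  have hrow : ∀ (X : Matrix (Fin M) (Fin N) 𝕜) i, ∑ j, r (singVal X) i j = singVal X i := by
    intro X i
    by_cases hi : (i : ℕ) < N
    · rw [Finset.sum_eq_single (⟨i, hi⟩ : Fin N)]
      · simp [r]
      · intro k _ hk
        have : (i : ℕ) ≠ k := fun h => hk (Fin.ext h.symm)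
        simp [r, this]
      · simp
    · rw [singVal_eq_zero_of_min_le X ((min_le_right _ _).trans (not_lt.1 hi))]
      refine Finset.sum_eq_zero fun k _ => ?_
      have : (i : ℕ) ≠ k := by have := k.2; omega
      simp [r, this]
  have hcol : ∀ (X : Matrix (Fin M) (Fin N) 𝕜) j, ∑ i, r (singVal X) i j = singVal X j := by
    intro X j
    by_cases hj : (j : ℕ) < M
    · rw [Finset.sum_eq_single (⟨j, hj⟩ : Fin M)]
      · simp [r]
      · intro k _ hk
        have : (k : ℕ) ≠ j := fun h => hk (Fin.ext h)
        simp [r, this]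
      · simp
    · rw [singVal_eq_zero_of_min_le X ((min_le_left _ _).trans (not_lt.1 hj))]
      refine Finset.sum_eq_zero fun k _ => ?_
      have : (k : ℕ) ≠ j := by have := k.2; omega
      simp [r, this]
  have htr : (Aᴴ * B).trace =
      ((rectDiag 𝕜 M N (singVal A))ᴴ * (P * rectDiag 𝕜 M N (singVal B) * Qᴴ)).trace := by
    conv_lhs => rw [hA, hB]
    simp only [hP, hQ, Matrix.conjTranspose_mul, Matrix.conjTranspose_conjTranspose,
      Matrix.mul_assoc]
    rw [Matrix.trace_mul_comm]
    simp only [Matrix.mul_assoc]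
  have hexp : (Aᴴ * B).trace = ∑ j : Fin N, ∑ i : Fin M, ∑ l : Fin N, ∑ k : Fin M,
      ((r (singVal A) i j * r (singVal B) k l : ℝ) : 𝕜) * (P i k * star (Q j l)) := by
    rw [htr, Matrix.trace]
    refine Finset.sum_congr rfl fun j _ => ?_
    rw [Matrix.diag_apply, Matrix.mul_apply]
    refine Finset.sum_congr rfl fun i _ => ?_
    rw [Matrix.mul_apply, Finset.mul_sum]
    refine Finset.sum_congr rfl fun l _ => ?_
    rw [Matrix.mul_apply, Finset.sum_mul, Finset.mul_sum]
    refine Finset.sum_congr rfl fun k _ => ?_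
    simp only [Matrix.conjTranspose_apply, hr, RCLike.star_def, RCLike.conj_ofReal]
    push_cast
    ring
  have hterm : ∀ i j k l, RCLike.re
      (((r (singVal A) i j * r (singVal B) k l : ℝ) : 𝕜) * (P i k * star (Q j l))) ≤
      (r (singVal A) i j * r (singVal B) k l * ‖P i k‖ ^ 2 +
        r (singVal A) i j * r (singVal B) k l * ‖Q j l‖ ^ 2) / 2 := by
    intro i j k l
    rw [RCLike.re_ofReal_mul]
    have h1 : RCLike.re (P i k * star (Q j l)) ≤ ‖P i k‖ * ‖Q j l‖ := by
      refine (RCLike.re_le_norm _).trans ?_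
      rw [norm_mul, norm_star]
    -- The arithmetic-geometric mean inequality decouples `P` from `Q`, leaving two sums weighted by
    -- doubly stochastic matrices.
    have h2 : RCLike.re (P i k * star (Q j l)) ≤ (‖P i k‖ ^ 2 + ‖Q j l‖ ^ 2) / 2 := by
      nlinarith [sq_nonneg (‖P i k‖ - ‖Q j l‖)]
    have := mul_le_mul_of_nonneg_left h2 (mul_nonneg (hr0 A i j) (hr0 B k l))
    linarith
  have hPsum : ∑ j : Fin N, ∑ i : Fin M, ∑ l : Fin N, ∑ k : Fin M,
      r (singVal A) i j * r (singVal B) k l * ‖P i k‖ ^ 2 =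
      ∑ i : Fin M, ∑ k : Fin M, singVal A i * singVal B k * ‖P i k‖ ^ 2 := by
    rw [Finset.sum_comm]
    refine Finset.sum_congr rfl fun i _ => ?_
    have e : ∀ j : Fin N, ∑ l : Fin N, ∑ k : Fin M,
        r (singVal A) i j * r (singVal B) k l * ‖P i k‖ ^ 2 =
        ∑ k : Fin M, r (singVal A) i j * (singVal B k * ‖P i k‖ ^ 2) := by
      intro j
      rw [Finset.sum_comm]
      refine Finset.sum_congr rfl fun k _ => ?_
      rw [← hrow B k, Finset.sum_mul, Finset.mul_sum]
      exact Finset.sum_congr rfl fun l _ => mul_assoc _ _ _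
    simp only [e]
    rw [Finset.sum_comm]
    refine Finset.sum_congr rfl fun k _ => ?_
    rw [← Finset.sum_mul, hrow A i, mul_assoc]
  have hQsum : ∑ j : Fin N, ∑ i : Fin M, ∑ l : Fin N, ∑ k : Fin M,
      r (singVal A) i j * r (singVal B) k l * ‖Q j l‖ ^ 2 =
      ∑ j : Fin N, ∑ l : Fin N, singVal A j * singVal B l * ‖Q j l‖ ^ 2 := by
    refine Finset.sum_congr rfl fun j _ => ?_
    rw [Finset.sum_comm]
    refine Finset.sum_congr rfl fun l _ => ?_
    rw [← hcol A j, ← hcol B l, Finset.sum_mul_sum, Finset.sum_mul]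
    exact Finset.sum_congr rfl fun i _ => by rw [Finset.sum_mul]
  calc RCLike.re (Aᴴ * B).trace ≤ ∑ j : Fin N, ∑ i : Fin M, ∑ l : Fin N, ∑ k : Fin M,
        (r (singVal A) i j * r (singVal B) k l * ‖P i k‖ ^ 2 +
        r (singVal A) i j * r (singVal B) k l * ‖Q j l‖ ^ 2) / 2 := by
        rw [hexp]
        simp only [map_sum]
        exact Finset.sum_le_sum fun j _ => Finset.sum_le_sum fun i _ =>
          Finset.sum_le_sum fun l _ => Finset.sum_le_sum fun k _ => hterm i j k l
    _ = (∑ i : Fin M, ∑ k : Fin M, singVal A i * singVal B k * ‖P i k‖ ^ 2 +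
        ∑ j : Fin N, ∑ l : Fin N, singVal A j * singVal B l * ‖Q j l‖ ^ 2) / 2 := by
        rw [← hPsum, ← hQsum]
        simp only [← Finset.sum_div, Finset.sum_add_distrib]
    _ ≤ _ := by
        have h1 := sum_singVal_mul_le A B (min_le_left M N) hPu
        have h2 := sum_singVal_mul_le A B (min_le_right M N) hQu
        linarith

/-- Equality in von Neumann's trace inequality for matrices with common singular vectors. -/
theorem re_trace_conjTranspose_mul_of_isSVD {A B : Matrix (Fin M) (Fin N) 𝕜}
    {U : Matrix (Fin M) (Fin M) 𝕜} {V : Matrix (Fin N) (Fin N) 𝕜}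
    (hA : IsSVD A U V) (hB : IsSVD B U V) :
    RCLike.re (Aᴴ * B).trace =
      ∑ j ∈ Finset.range (min M N), singVal A j * singVal B j := by
  obtain ⟨hU, hV, hA⟩ := hA
  have hd := fun (j : ℕ) (hj : M ≤ j) =>
    singVal_eq_zero_of_min_le A ((min_le_left M N).trans hj)
  conv_lhs => rw [hA, hB.2.2]
  rw [conjTranspose_mul_of_common_svd hU hd, Matrix.trace_mul_comm, ← Matrix.mul_assoc,
    show Vᴴ * V = 1 from Matrix.mem_unitaryGroup_iff'.1 hV, Matrix.one_mul, Matrix.trace_diagonal,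
    map_sum]
  simp only [RCLike.ofReal_re]
  exact sum_fin_eq_sum_range_min (min_le_right M N) (f := fun j => singVal A j * singVal B j)
    (fun j hj => by simp [singVal_eq_zero_of_min_le A hj])

theorem frobenius_norm_sq_eq_sum_singVal_sq (A : Matrix (Fin M) (Fin N) 𝕜) :
    ‖A‖ ^ 2 = ∑ j ∈ Finset.range (min M N), singVal A j ^ 2 := by
  obtain ⟨U, V, h⟩ := exists_isSVD A
  rw [norm_sq_eq_re_inner (𝕜 := 𝕜) A]
  simp only [sq]
  exact re_trace_conjTranspose_mul_of_isSVD h h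

end TraceInequality

/-! ### The scalar problem -/

section Scalar

/-- The function relating the singular values of `q F + P_{H^⊥}(W)` to those of the minimizer. -/
noncomputable def tFun (τ q σ : ℝ) : ℝ := (σ - sFun τ q σ) / (q - 1)

variable {τ q : ℝ}

theorem sFun_add_mul_tFun (hq : 1 < q) (z : ℝ) :
    sFun τ q z + (q - 1) * tFun τ q z = z := by
  have : q - 1 ≠ 0 := by linarith
  rw [tFun, mul_div_cancel₀ _ this]
  ring

/-- The graph of `z ↦ (s, t)` has three pieces: along `t = 0` up to `s = τ`, then up the vertical
segment `s = τ`, `0 ≤ t ≤ τ`, then along the diagonal `t = s`. The breakpoints are `z = τ` and `z =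
qτ`, because `z = s + (q - 1) t`. -/
theorem sFun_tFun_cases (τ : ℝ) (hq : 1 < q) {z : ℝ} (hz : 0 ≤ z) :
    (z ≤ τ ∧ sFun τ q z = z ∧ tFun τ q z = 0) ∨
    (τ < z ∧ z ≤ q * τ ∧ sFun τ q z = τ ∧ 0 < tFun τ q z ∧ tFun τ q z ≤ τ) ∨
    (q * τ < z ∧ τ < sFun τ q z ∧ tFun τ q z = sFun τ q z ∧ z = q * sFun τ q z) := by
  have hq0 : 0 < q := by linarith
  have hq1 : 0 < q - 1 := by linarith
  have hst := sFun_add_mul_tFun (τ := τ) hq z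
  rcases le_or_gt z τ with h1 | h1
  · left
    have hs : sFun τ q z = z := by
      rw [sFun, min_eq_left h1, max_eq_left (div_le_self hz hq.le)]
    refine ⟨h1, hs, ?_⟩
    rw [tFun, hs, sub_self, zero_div]
  · right
    rcases le_or_gt z (q * τ) with h2 | h2
    · left
      have hs : sFun τ q z = τ := by
        rw [sFun, min_eq_right h1.le, max_eq_left]
        rw [div_le_iff₀ hq0]
        linarith
      rw [hs] at hst
      refine ⟨h1, h2, hs, ?_, ?_⟩
      · by_contra h
        nlinarith
      · by_contra h
        nlinarith
    · right
      have hτz : τ < z / q := by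
        rw [lt_div_iff₀ hq0]
        linarith
      have hs : sFun τ q z = z / q := by
        rw [sFun, min_eq_right h1.le, max_eq_right hτz.le]
      have hz' : z = q * sFun τ q z := by
        rw [hs]
        field_simp
      refine ⟨h2, hs ▸ hτz, ?_, hz'⟩
      have : (q - 1) * tFun τ q z = (q - 1) * sFun τ q z := by linarith
      exact mul_left_cancel₀ hq1.ne' this

theorem sFun_nonneg (hτ : 0 < τ) (hq : 1 < q) {z : ℝ} (hz : 0 ≤ z) : 0 ≤ sFun τ q z := by
  rcases sFun_tFun_cases τ hq hz with h | h | h <;> linarith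

theorem tFun_nonneg (hτ : 0 < τ) (hq : 1 < q) {z : ℝ} (hz : 0 ≤ z) : 0 ≤ tFun τ q z := by
  rcases sFun_tFun_cases τ hq hz with h | h | h <;> linarith

theorem sFun_zero (hτ : 0 < τ) (hq : 1 < q) : sFun τ q 0 = 0 := by
  have := sFun_tFun_cases τ hq (le_refl (0 : ℝ))
  rcases this with h | h | h
  · exact h.2.1
  · linarith
  · nlinarith

theorem tFun_zero (hτ : 0 < τ) (hq : 1 < q) : tFun τ q 0 = 0 := by
  simp [tFun, sFun_zero hτ hq]

theorem sFun_mono (hq : 1 < q) : Monotone (sFun τ q) := by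
  intro z z' h
  have hq0 : 0 < q := by linarith
  exact max_le_max (min_le_min_right _ h) (div_le_div_of_nonneg_right h hq0.le)

/-- The slopes of `t` on the three pieces are `0`, `1 / (q - 1)` and `1 / q`. Monotonicity keeps the
transformed singular values in non-increasing order. -/
theorem tFun_mono (hτ : 0 < τ) (hq : 1 < q) {z z' : ℝ} (hz : 0 ≤ z) (h : z ≤ z') :
    tFun τ q z ≤ tFun τ q z' := by
  have h1 := sFun_add_mul_tFun (τ := τ) hq z
  have h2 := sFun_add_mul_tFun (τ := τ) hq z'
  rcases sFun_tFun_cases τ hq hz with ⟨a1, a2, a3⟩ | ⟨a1, a2, a3, a4, a5⟩ | ⟨a1, a2, a3, a4⟩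
  · rw [a3]
    exact tFun_nonneg hτ hq (hz.trans h)
  · rcases sFun_tFun_cases τ hq (hz.trans h) with
      ⟨b1, b2, b3⟩ | ⟨b1, b2, b3, b4, b5⟩ | ⟨b1, b2, b3, b4⟩
    · linarith
    · by_contra h
      nlinarith
    · linarith
  · rcases sFun_tFun_cases τ hq (hz.trans h) with
      ⟨b1, b2, b3⟩ | ⟨b1, b2, b3, b4, b5⟩ | ⟨b1, b2, b3, b4⟩
    · nlinarith
    · linarith
    · by_contra h
      nlinarith

/-- `tFun` minimizes the scalar version of `R_τ(A) + ‖A - W‖²`. -/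
theorem scalar_objective_le {s t a : ℝ} (ha : 0 ≤ a)
    (hst : (s ≤ τ ∧ t = 0) ∨ (s = τ ∧ 0 ≤ t ∧ t ≤ τ) ∨ (τ < s ∧ t = s)) (hτ : 0 < τ) :
    (τ ^ 2 - max (τ - t) 0 ^ 2) + t ^ 2 - 2 * (t * s) ≤
      (τ ^ 2 - max (τ - a) 0 ^ 2) + a ^ 2 - 2 * (a * s) := by
  -- As a function of `a`, the objective is the linear function `2a(τ - s)` on `[0, τ]` and the
  -- parabola `τ² + (a - s)² - s²` beyond `τ`. At `s = τ` it is flat on `[0, τ]`, which is why `t`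
  -- is then free in that interval.
  rcases hst with ⟨h1, rfl⟩ | ⟨rfl, h1, h2⟩ | ⟨h1, rfl⟩
  · rcases le_total a τ with h | h
    · rw [max_eq_left (by linarith), max_eq_left (by linarith)]
      nlinarith
    · rw [max_eq_left (by linarith), max_eq_right (by linarith)]
      nlinarith
  · rcases le_total a s with h | h
    · rw [max_eq_left (by linarith), max_eq_left (by linarith)]
      nlinarith
    · rw [max_eq_left (by linarith), max_eq_right (by linarith)]
      nlinarith
  · rcases le_total a τ with h | h
    · rw [max_eq_right (by linarith), max_eq_left (by linarith)]
      nlinarith [mul_nonneg ha (sub_nonneg.2 h1.le), mul_nonneg (sub_nonneg.2 h) (sub_nonneg.2 h1.le)]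
    · rw [max_eq_right (by linarith), max_eq_right (by linarith)]
      nlinarith [sq_nonneg (a - t)]

end Scalar

/-! ### The regularizer and the rank -/

section Regularizer

variable {𝕜 : Type*} [RCLike 𝕜] {M N : ℕ} {τ : ℝ}

/-- A zero singular value contributes `τ² - τ² = 0`. What remains is one term, at most `τ²`, for
each unit of rank. -/
theorem rankReg_eq_sum_range_rank (hτ : 0 < τ) (A : Matrix (Fin M) (Fin N) 𝕜) :
    rankReg τ A = ∑ j ∈ Finset.range A.rank, (τ ^ 2 - (max (τ - singVal A j) 0) ^ 2) := by
  symm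
  refine Finset.sum_subset (Finset.range_subset_range.2 (rank_le_min A)) fun j _ hj => ?_
  rw [(singVal_eq_zero_iff_rank_le A j).2 (by simpa using hj), sub_zero, max_eq_left hτ.le,
    sub_self]

theorem rankReg_le_sq_mul_rank (hτ : 0 < τ) (A : Matrix (Fin M) (Fin N) 𝕜) :
    rankReg τ A ≤ τ ^ 2 * (A.rank : ℝ) := by
  rw [rankReg_eq_sum_range_rank hτ]
  refine (Finset.sum_le_card_nsmul _ _ (τ ^ 2) fun j _ => ?_).trans (by simp [mul_comm])
  linarith [sq_nonneg (max (τ - singVal A j) 0)]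

theorem rankReg_eq_sq_mul_rank (hτ : 0 < τ) {A : Matrix (Fin M) (Fin N) 𝕜}
    (h : ∀ j, singVal A j = 0 ∨ τ ≤ singVal A j) : rankReg τ A = τ ^ 2 * (A.rank : ℝ) := by
  rw [rankReg_eq_sum_range_rank hτ, Finset.sum_congr rfl (g := fun _ => τ ^ 2)]
  · simp [mul_comm]
  · intro j hj
    have hj' : singVal A j ≠ 0 := by
      rw [Ne, singVal_eq_zero_iff_rank_le, not_le]
      simpa using hj
    rw [max_eq_right (by linarith [(h j).resolve_left hj'])]
    simp

theorem norm_sub_sq_eq_re_trace (A W : Matrix (Fin M) (Fin N) 𝕜) :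
    ‖A - W‖ ^ 2 = ‖A‖ ^ 2 - 2 * RCLike.re (Aᴴ * W).trace + ‖W‖ ^ 2 :=
  norm_sub_sq (𝕜 := 𝕜) A W

/-- A matrix with the singular vectors of `W` and with optimal singular values minimizes
`R_τ(A) + ‖A - W‖²`. -/
theorem rankReg_add_norm_sub_sq_le (hτ : 0 < τ) {A₀ W : Matrix (Fin M) (Fin N) 𝕜}
    {U : Matrix (Fin M) (Fin M) 𝕜} {V : Matrix (Fin N) (Fin N) 𝕜}
    (hA₀ : IsSVD A₀ U V) (hW : IsSVD W U V)
    (h : ∀ j, (singVal W j ≤ τ ∧ singVal A₀ j = 0) ∨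
      (singVal W j = τ ∧ 0 ≤ singVal A₀ j ∧ singVal A₀ j ≤ τ) ∨
      (τ < singVal W j ∧ singVal A₀ j = singVal W j))
    (A : Matrix (Fin M) (Fin N) 𝕜) :
    rankReg τ A₀ + ‖A₀ - W‖ ^ 2 ≤ rankReg τ A + ‖A - W‖ ^ 2 := by
  have h1 := re_trace_conjTranspose_mul_le A W
  have h2 := re_trace_conjTranspose_mul_of_isSVD hA₀ hW
  have h3 : ∑ j ∈ Finset.range (min M N), ((τ ^ 2 - max (τ - singVal A₀ j) 0 ^ 2) +
      singVal A₀ j ^ 2 - 2 * (singVal A₀ j * singVal W j)) ≤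
      ∑ j ∈ Finset.range (min M N), ((τ ^ 2 - max (τ - singVal A j) 0 ^ 2) +
      singVal A j ^ 2 - 2 * (singVal A j * singVal W j)) :=
    Finset.sum_le_sum fun j _ => scalar_objective_le (singVal_nonneg A j) (h j) hτ
  have hsplit : ∀ B : Matrix (Fin M) (Fin N) 𝕜,
      ∑ j ∈ Finset.range (min M N), ((τ ^ 2 - max (τ - singVal B j) 0 ^ 2) +
        singVal B j ^ 2 - 2 * (singVal B j * singVal W j)) =
      rankReg τ B + ‖B‖ ^ 2 - 2 * ∑ j ∈ Finset.range (min M N), singVal B j * singVal W j := by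
    intro B
    rw [frobenius_norm_sq_eq_sum_singVal_sq, rankReg, Finset.mul_sum, ← Finset.sum_add_distrib,
      ← Finset.sum_sub_distrib]
  rw [hsplit, hsplit, ← h2] at h3
  rw [norm_sub_sq_eq_re_trace, norm_sub_sq_eq_re_trace]
  linarith

/-- On `H` the objective `q ‖A - F‖²` equals `‖A - W‖² + (q - 1) ‖A - A₀‖²` up to a constant. -/
theorem mul_norm_sub_sq_sub_eq {𝕜 E : Type*} [RCLike 𝕜] [NormedAddCommGroup E]
    [InnerProductSpace 𝕜 E] {H : Submodule 𝕜 E} {F W A₀ A B : E} {q : ℝ}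
    (h : W + ((q - 1 : ℝ) : 𝕜) • A₀ - (q : 𝕜) • F ∈ Hᗮ) (hA : A ∈ H) (hB : B ∈ H) :
    q * ‖A - F‖ ^ 2 - (‖A - W‖ ^ 2 + (q - 1) * ‖A - A₀‖ ^ 2) =
      q * ‖B - F‖ ^ 2 - (‖B - W‖ ^ 2 + (q - 1) * ‖B - A₀‖ ^ 2) := by
  have key : ∀ C ∈ H, RCLike.re (inner 𝕜 C W) + (q - 1) * RCLike.re (inner 𝕜 C A₀) =
      q * RCLike.re (inner 𝕜 C F) := by
    intro C hC
    have := congrArg RCLike.re (Submodule.inner_right_of_mem_orthogonal hC h)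
    rw [inner_sub_right, inner_add_right, inner_smul_right, inner_smul_right, map_sub, map_add,
      RCLike.re_ofReal_mul, RCLike.re_ofReal_mul, map_zero] at this
    linarith
  simp only [norm_sub_sq (𝕜 := 𝕜)]
  -- The quadratic terms cancel because `q = 1 + (q - 1)`, the linear terms cancel by orthogonality,
  -- and the constants drop out of the difference.
  linear_combination 2 * key A hA - 2 * key B hB

end Regularizer

/-! ### The fixed point and its minimizer -/

theorem theorem5p2 {𝕜 : Type*} [RCLike 𝕜] {M N : ℕ}
    (H : Submodule 𝕜 (Matrix (Fin M) (Fin N) 𝕜))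
    (F : Matrix (Fin M) (Fin N) 𝕜) (hF : F ∈ H)
    (τ q : ℝ) (hτ : 0 < τ) (hq : 1 < q)
    (W₀ A₀ : Matrix (Fin M) (Fin N) 𝕜)
    (hW₀ : fixedPointMap H F τ q W₀ = W₀)
    (hA₀ : A₀ = ((q - 1 : ℝ) : 𝕜)⁻¹ • ((q : 𝕜) • F - orthProj H W₀)) :
    -- `A₀` is the unique minimizer of the relaxed problem over `H`
    (A₀ ∈ H ∧ ∀ A ∈ H, A ≠ A₀ →
      rankReg τ A₀ + q * ‖A₀ - F‖ ^ 2 < rankReg τ A + q * ‖A - F‖ ^ 2) ∧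
    -- `A₀` minimizes `R_τ(A) + ‖A - W₀‖²` over all matrices
    (∀ A : Matrix (Fin M) (Fin N) 𝕜,
      rankReg τ A₀ + ‖A₀ - W₀‖ ^ 2 ≤ rankReg τ A + ‖A - W₀‖ ^ 2) ∧
    -- `A₀` and `W₀` have the same singular vectors
    (∃ U V, IsSVD W₀ U V ∧ IsSVD A₀ U V) ∧
    ((∀ i < min M N, ∀ j < min M N, singVal W₀ i = τ → singVal W₀ j = τ → i = j) →
      ∀ U V, IsSVD W₀ U V → IsSVD A₀ U V) ∧
    -- the singular values of `A₀`
    (∀ j < min M N,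
      (τ < singVal W₀ j → singVal A₀ j = singVal W₀ j) ∧
      (singVal W₀ j = τ → 0 ≤ singVal A₀ j ∧ singVal A₀ j ≤ singVal W₀ j) ∧
      (singVal W₀ j < τ → singVal A₀ j = 0)) ∧
    -- if `τ` is not a singular value of `W₀`, then `A₀` is the solution of the non-convex problem
    ((∀ j < min M N, singVal W₀ j ≠ τ) →
      ∀ A ∈ H, A ≠ A₀ →
        τ ^ 2 * (A₀.rank : ℝ) + q * ‖A₀ - F‖ ^ 2 < τ ^ 2 * (A.rank : ℝ) + q * ‖A - F‖ ^ 2) := by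
  have hq1 : 0 < q - 1 := by linarith
  have hq1' : ((q - 1 : ℝ) : 𝕜) ≠ 0 := by exact_mod_cast hq1.ne'
  set Z : Matrix (Fin M) (Fin N) 𝕜 := (q : 𝕜) • F + orthProj H.orthogonal W₀ with hZ
  have hproj : orthProj H W₀ + orthProj H.orthogonal W₀ = W₀ :=
    H.starProjection_add_starProjection_orthogonal W₀
  have hsum : W₀ + ((q - 1 : ℝ) : 𝕜) • A₀ = Z := by
    rw [hA₀, smul_inv_smul₀ hq1', hZ]
    nth_rewrite 1 [← hproj]
    abel
  have hAH : A₀ ∈ H := by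
    rw [hA₀]
    exact H.smul_mem _ (H.sub_mem (H.smul_mem _ hF) (H.starProjection_apply_mem W₀))
  have horth : W₀ + ((q - 1 : ℝ) : 𝕜) • A₀ - (q : 𝕜) • F ∈ H.orthogonal := by
    rw [hsum, hZ, add_sub_cancel_left]
    exact H.orthogonal.starProjection_apply_mem W₀
  obtain ⟨U, V, hSVD, hW⟩ : ∃ U V, IsSVD Z U V ∧
      W₀ = U * rectDiag 𝕜 M N (fun j => sFun τ q (singVal Z j)) * Vᴴ :=
    ⟨_, _, (exists_isSVD Z).choose_spec.choose_spec, hW₀.symm⟩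
  obtain ⟨hU, hV, hZUV⟩ := hSVD
  have hA : A₀ = U * rectDiag 𝕜 M N (fun j => tFun τ q (singVal Z j)) * Vᴴ := by
    -- Splitting `z = s(z) + (q - 1) t(z)` on the diagonal allows `W₀` to be cancelled from `W₀ + (q
    -- - 1) A₀ = Z`.
    have hdiag : rectDiag 𝕜 M N (singVal Z) =
        rectDiag 𝕜 M N (fun j => sFun τ q (singVal Z j)) +
          ((q - 1 : ℝ) : 𝕜) • rectDiag 𝕜 M N (fun j => tFun τ q (singVal Z j)) := by
      ext i j
      simp only [rectDiag, Matrix.of_apply, Matrix.add_apply, Matrix.smul_apply, smul_eq_mul]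
      split_ifs
      · rw [← RCLike.ofReal_mul, ← RCLike.ofReal_add, sFun_add_mul_tFun hq]
      · simp
    have h := hsum.trans hZUV
    rw [hdiag, Matrix.mul_add, Matrix.add_mul, ← hW, Matrix.mul_smul, Matrix.smul_mul] at h
    exact smul_right_injective _ hq1' (add_left_cancel h)
  have hz := singVal_nonneg Z
  have hz0 : ∀ j, min M N ≤ j → singVal Z j = 0 := fun j hj => singVal_eq_zero_of_min_le Z hj
  have hs_anti : Antitone fun j => sFun τ q (singVal Z j) :=
    fun i j hij => sFun_mono hq (singVal_antitone Z hij)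
  have ht_anti : Antitone fun j => tFun τ q (singVal Z j) :=
    fun i j hij => tFun_mono hτ hq (hz j) (singVal_antitone Z hij)
  have hs0 : ∀ j, 0 ≤ sFun τ q (singVal Z j) := fun j => sFun_nonneg hτ hq (hz j)
  have ht0 : ∀ j, 0 ≤ tFun τ q (singVal Z j) := fun j => tFun_nonneg hτ hq (hz j)
  have hsm : ∀ j, min M N ≤ j → sFun τ q (singVal Z j) = 0 := fun j hj => by
    rw [hz0 j hj, sFun_zero hτ hq]
  have htm : ∀ j, min M N ≤ j → tFun τ q (singVal Z j) = 0 := fun j hj => by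
    rw [hz0 j hj, tFun_zero hτ hq]
  have hσW : singVal W₀ = fun j => sFun τ q (singVal Z j) :=
    singVal_eq_of_eq_mul_rectDiag_mul hU hV hs_anti hs0 hsm hW
  have hσA : singVal A₀ = fun j => tFun τ q (singVal Z j) :=
    singVal_eq_of_eq_mul_rectDiag_mul hU hV ht_anti ht0 htm hA
  have hWsvd : IsSVD W₀ U V := isSVD_of_eq_mul_rectDiag_mul hU hV hs_anti hs0 hsm hW
  have hAsvd : IsSVD A₀ U V := isSVD_of_eq_mul_rectDiag_mul hU hV ht_anti ht0 htm hA
  have hcases : ∀ j, (singVal W₀ j ≤ τ ∧ singVal A₀ j = 0) ∨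
      (singVal W₀ j = τ ∧ 0 ≤ singVal A₀ j ∧ singVal A₀ j ≤ τ) ∨
      (τ < singVal W₀ j ∧ singVal A₀ j = singVal W₀ j) := by
    intro j
    rw [hσW, hσA]
    rcases sFun_tFun_cases τ hq (hz j) with ⟨a1, a2, a3⟩ | ⟨a1, a2, a3, a4, a5⟩ | ⟨a1, a2, a3, a4⟩
    · exact Or.inl ⟨a2.trans_le a1, a3⟩
    · exact Or.inr (Or.inl ⟨a3, a4.le, a5⟩)
    · exact Or.inr (Or.inr ⟨a2, a3⟩)
  have hmin := rankReg_add_norm_sub_sq_le hτ hAsvd hWsvd hcases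
  have hmain : ∀ A ∈ H, A ≠ A₀ →
      rankReg τ A₀ + q * ‖A₀ - F‖ ^ 2 < rankReg τ A + q * ‖A - F‖ ^ 2 := by
    intro A hAmem hne
    have h1 := hmin A
    -- Comparison with `A₀` itself, where the term `(q - 1) ‖A - A₀‖²` vanishes.
    have h2 := mul_norm_sub_sq_sub_eq horth hAmem hAH
    have h3 : 0 < (q - 1) * ‖A - A₀‖ ^ 2 :=
      mul_pos hq1 (pow_pos (norm_pos_iff.2 (sub_ne_zero.2 hne)) 2)
    simp only [sub_self, norm_zero] at h2
    linarith
  refine ⟨⟨hAH, hmain⟩, hmin, ⟨U, V, hWsvd, hAsvd⟩, ?_, ?_, ?_⟩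
  · rintro huniq U' V' ⟨hU', hV', hW'⟩
    refine ⟨hU', hV', ?_⟩
    refine hAsvd.2.2.trans (mul_rectDiag_mul_eq_of_eq hU hV hU' hV' (d := singVal W₀)
      (f := singVal A₀) (singVal_nonneg W₀) (fun j hj => singVal_eq_zero_of_min_le W₀ hj)
      ?_ ?_ (hWsvd.2.2.symm.trans hW'))
    · intro j hj
      rcases hcases j with h | h | h
      · exact h.2
      · linarith
      · linarith
    · intro i j hij
      -- Away from the level `τ`, `σ_j(A₀)` is determined by `σ_j(W₀)`. At `τ` it is not, and the
      -- hypothesis that the level occurs at most once is needed; the zero padding never reaches it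
      -- since `τ > 0`.
      by_cases hi : singVal W₀ i = τ
      · have hlt : ∀ k, singVal W₀ k = τ → k < min M N := by
          intro k hk
          by_contra hc
          rw [singVal_eq_zero_of_min_le W₀ (not_lt.1 hc)] at hk
          exact hτ.ne hk
        have hj : singVal W₀ j = τ := hij ▸ hi
        rw [huniq i (hlt i hi) j (hlt j hj) hi hj]
      · have hj : singVal W₀ j ≠ τ := hij ▸ hi
        rcases hcases i with h | h | h <;> rcases hcases j with h' | h' | h'
        · rw [h.2, h'.2]
        · exact absurd h'.1 hj
        · linarith [h.1, h'.1]
        · exact absurd h.1 hi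
        · exact absurd h.1 hi
        · exact absurd h.1 hi
        · linarith [h.1, h'.1]
        · exact absurd h'.1 hj
        · rw [h.2, h'.2, hij]
  · intro j _
    refine ⟨fun h => ?_, fun h => ⟨singVal_nonneg A₀ j, ?_⟩, fun h => ?_⟩
    · rcases hcases j with h' | h' | h'
      · linarith
      · linarith
      · exact h'.2
    · rcases hcases j with h' | h' | h' <;> linarith
    · rcases hcases j with h' | h' | h'
      · exact h'.2
      · linarith
      · linarith
  · intro hne A hAmem hAne
    have hrank : rankReg τ A₀ = τ ^ 2 * (A₀.rank : ℝ) := by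
      refine rankReg_eq_sq_mul_rank hτ fun j => ?_
      rcases lt_or_ge j (min M N) with hj | hj
      · rcases hcases j with h | h | h
        · exact Or.inl h.2
        · exact absurd h.1 (hne j hj)
        · exact Or.inr (h.2 ▸ h.1.le)
      · exact Or.inl (singVal_eq_zero_of_min_le A₀ hj)
    rw [← hrank]
    -- `R_τ` bounds the rank penalty from below everywhere and agrees with it at `A₀`, so strict
    -- minimality carries over.
    exact (hmain A hAmem hAne).trans_le (by linarith [rankReg_le_sq_mul_rank hτ A])
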